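/- Let $d\ge 2$ be an integer and let $\gamma>d$ be real. Let $\mu_d$ be the isometry-invariant measure on the space of (unoriented) lines in $\mathbb{R}^d$, normalized so that the set of lines hitting a convex body $K$ has measure half the surface area of $K$. Let $\Pi$ be the (improper) Poisson line process marked by speed-limits, i.e. a Poisson point process of marked lines $(\ell,v)$, $v\in(0,\infty)$, with intensity measure $(\gamma-1)v^{-\gamma}\,\mathrm{d}v\,\mu_d(\mathrm{d}\ell)$. For $v>0$ let $\mathcal S_v=\bigcup\{\ell : (\ell,w)\in\Pi,\ w\ge v\}$. A $\Pi$-path with terminal time $T\in(0,\infty]$ is a locally Lipschitz path $\xi:[0,T)\to\mathbb{R}^d$ such that, for every $v>0$, the set $\{t\in[0,T) : |\xi'(t)|>v \text{ and } \xi(t)\notin\mathcal S_v\}$ is Lebesgue-null. Then, for any two specified points $x_1,x_2\in\mathbb{R}^d$, almost surely there are a finite time $T>0$ and a continuous path $\xi:[0,T]\to\mathbb{R}^d$ whose restriction to $[0,T)$ is a $\Pi$-path, with $\xi(0)=x_1$ and $\xi(T)=x_2$. -/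

import Mathlib

open MeasureTheory ProbabilityTheory Set Filter Topology
open scoped ENNReal NNReal RealInnerProductSpace

noncomputable section

/-- `d`-dimensional Euclidean space. -/
abbrev Euc (d : ℕ) : Type := EuclideanSpace ℝ (Fin d)

/-! ### Line space and the invariant line measure -/

/-- The space of all un-sensed lines (one-dimensional affine subspaces) of `ℝ^d`. -/
def LineSpace (d : ℕ) : Type :=
  {l : AffineSubspace ℝ (Euc d) // (l : Set (Euc d)).Nonempty ∧ Module.finrank ℝ l.direction = 1}

/-- The points of a line. -/
def LineSpace.points {d : ℕ} (l : LineSpace d) : Set (Euc d) := (l.1 : Set (Euc d))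

/-- The line through the point `p.1` with direction the unit vector `p.2`. -/
def lineThrough {d : ℕ} (p : Euc d × Metric.sphere (0 : Euc d) 1) : LineSpace d :=
  ⟨AffineSubspace.mk' p.1 (Submodule.span ℝ {(p.2 : Euc d)}),
    ⟨p.1, AffineSubspace.self_mem_mk' _ _⟩, by
      rw [AffineSubspace.direction_mk']
      exact finrank_span_singleton (ne_zero_of_mem_unit_sphere p.2)⟩

/-- Line space as a measurable space: it is a quotient of the space of pairs (point, direction),
and carries the quotient σ-algebra. -/
instance (d : ℕ) : MeasurableSpace (LineSpace d) :=
  MeasurableSpace.map (lineThrough (d := d)) inferInstance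

theorem measurable_lineThrough (d : ℕ) : Measurable (lineThrough (d := d)) :=
  Measurable.of_le_map le_rfl

/-- The volume `κ_s` of the unit ball of `ℝ^s`. -/
def unitBallVolume (s : ℕ) : ℝ≥0∞ := volume (Metric.ball (0 : Euc s) 1)

/-- The set of pairs `(x, u)` for which `x` lies in the slab `0 ≤ ⟪x, u⟫ ≤ 1`. -/
def unitSlab (d : ℕ) : Set (Euc d × Metric.sphere (0 : Euc d) 1) :=
  {p | ⟪p.1, (p.2 : Euc d)⟫ ∈ Icc (0 : ℝ) 1}

/-- The isometry-invariant measure `μ_d` on line space, normalized so that the set of lines hitting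
a convex body `K` has measure half the surface area of `K`. In terms of the direction `u` of a line
and of its intersection point `y` with the hyperplane orthogonal to `u`, it is
`(1 / κ_{d-1}) dy du`, with `u` in a hemisphere, equivalently `(1 / (2 κ_{d-1})) dy du` with `u` in
the whole unit sphere (see `invariantLineMeasure_apply`). The measure `dy` is
obtained by projecting, along `u`, Lebesgue measure on a slab of unit thickness. -/
def invariantLineMeasure (d : ℕ) : Measure (LineSpace d) :=
  (2 * unitBallVolume (d - 1))⁻¹ •
    (((volume : Measure (Euc d)).prod (volume : Measure (Euc d)).toSphere).restrict
      (unitSlab d)).map lineThrough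

theorem measurableSet_unitSlab (d : ℕ) : MeasurableSet (unitSlab d) := by
  apply measurableSet_Icc.preimage
  apply Continuous.measurable
  fun_prop

theorem lineThrough_add {d : ℕ} (x : Euc d) (u : Metric.sphere (0 : Euc d) 1) (y : Euc d)
    (hy : y ∈ Submodule.span ℝ {(u : Euc d)}) : lineThrough (y + x, u) = lineThrough (x, u) := by
  apply Subtype.ext
  apply AffineSubspace.ext_of_direction_eq
  · simp [lineThrough]
  · exact ⟨x, by simpa [lineThrough, AffineSubspace.mem_mk'] using neg_mem hy,
      AffineSubspace.self_mem_mk' _ _⟩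

theorem volume_unitSlab_fibre {d : ℕ} (u : Metric.sphere (0 : Euc d) 1) (A : Set (LineSpace d)) :
    volume {x : Euc d | ⟪x, (u : Euc d)⟫ ∈ Icc (0 : ℝ) 1 ∧ lineThrough (x, u) ∈ A} =
      volume {y : (Submodule.span ℝ {(u : Euc d)})ᗮ | lineThrough ((y : Euc d), u) ∈ A} := by
  have hu : ‖(u : Euc d)‖ = 1 := norm_eq_of_mem_sphere u
  set s : Submodule ℝ (Euc d) := Submodule.span ℝ {(u : Euc d)} with hs
  let e : Euc d ≃ᵐ s × sᗮ := s.orthogonalDecomposition.toHomeomorph.toMeasurableEquiv.trans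
    (MeasurableEquiv.toLp 2 _).symm
  have he : MeasurePreserving e volume volume :=
    s.orthogonalDecomposition.measurePreserving.trans (WithLp.volume_preserving_ofLp _ _)
  have hsymm : ∀ q : s × sᗮ, e.symm q = (q.1 : Euc d) + q.2 := by
    intro q
    simp [e]
  have hset : e.symm ⁻¹' {x : Euc d | ⟪x, (u : Euc d)⟫ ∈ Icc (0 : ℝ) 1 ∧ lineThrough (x, u) ∈ A} =
      {a : s | ⟪(a : Euc d), (u : Euc d)⟫ ∈ Icc (0 : ℝ) 1} ×ˢ
        {y : sᗮ | lineThrough ((y : Euc d), u) ∈ A} := by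
    ext q
    have h1 : ⟪(q.2 : Euc d), (u : Euc d)⟫ = 0 := by
      rw [real_inner_comm]
      exact (Submodule.mem_orthogonal s _).1 q.2.2 _ (Submodule.mem_span_singleton_self _)
    simp only [mem_preimage, hsymm, mem_ofPred_eq, mem_prod, inner_add_left, h1, add_zero,
      lineThrough_add _ _ _ q.1.2]
  have hone : volume {a : s | ⟪(a : Euc d), (u : Euc d)⟫ ∈ Icc (0 : ℝ) 1} = 1 := by
    let f := LinearIsometryEquiv.toSpanUnitSingleton (𝕜 := ℝ) (u : Euc d) hu
    have hf := f.measurePreserving.measure_preimage_equiv (f := f.toHomeomorph.toMeasurableEquiv)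
      {a : s | ⟪(a : Euc d), (u : Euc d)⟫ ∈ Icc (0 : ℝ) 1}
    rw [← hf]
    have : f.toHomeomorph.toMeasurableEquiv ⁻¹'
        {a : s | ⟪(a : Euc d), (u : Euc d)⟫ ∈ Icc (0 : ℝ) 1} = Icc (0 : ℝ) 1 := by
      ext t
      have h2 : ((f t : s) : Euc d) = t • (u : Euc d) := rfl
      change ⟪((f t : s) : Euc d), (u : Euc d)⟫ ∈ Icc (0 : ℝ) 1 ↔ _
      rw [h2, real_inner_smul_left, real_inner_self_eq_norm_sq, hu]
      simp
    rw [this]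
    simp
  rw [← he.symm.measure_preimage_equiv, hset, Measure.volume_eq_prod, Measure.prod_prod, hone,
    one_mul]

/-- Disintegration of the invariant line measure over the direction of the line. -/
theorem invariantLineMeasure_apply (d : ℕ) {A : Set (LineSpace d)} (hA : MeasurableSet A) :
    invariantLineMeasure d A = (2 * unitBallVolume (d - 1))⁻¹ *
      ∫⁻ u, volume {y : (Submodule.span ℝ {(u : Euc d)})ᗮ | lineThrough ((y : Euc d), u) ∈ A}
        ∂(volume : Measure (Euc d)).toSphere := by
  rw [invariantLineMeasure, Measure.smul_apply, smul_eq_mul,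
    Measure.map_apply (measurable_lineThrough d) hA,
    Measure.restrict_apply (measurable_lineThrough d hA),
    Measure.prod_apply_symm ((measurable_lineThrough d hA).inter (measurableSet_unitSlab d))]
  congr 1
  refine lintegral_congr fun u => ?_
  rw [← volume_unitSlab_fibre u A]
  congr 1
  ext x
  simp [unitSlab, and_comm]

/-! ### Poisson point processes -/

/-- The Poisson distribution with mean `r ∈ [0, ∞]`; for `r = ∞` it is the point mass at `∞`. -/
def poissonLaw (r : ℝ≥0∞) : Measure ℕ∞ :=
  if r = ∞ then Measure.dirac ⊤ else (poissonMeasure r.toNNReal).map (fun n : ℕ => (n : ℕ∞))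

/-- The random set `N` of points of `X` is a Poisson point process with intensity measure `Λ`:
the number of points in a measurable set `A` is a random variable with the Poisson distribution of
mean `Λ A`, and the numbers of points in pairwise disjoint measurable sets are independent. -/
structure IsPoissonProcess {Ω X : Type*} [MeasurableSpace Ω] [MeasurableSpace X]
    (P : Measure Ω) (N : Ω → Set X) (Λ : Measure X) : Prop where
  measurable_count : ∀ A : Set X, MeasurableSet A → Measurable fun ω => (N ω ∩ A).encard
  map_count : ∀ A : Set X, MeasurableSet A → P.map (fun ω => (N ω ∩ A).encard) = poissonLaw (Λ A)
  iIndepFun_count : ∀ A : ℕ → Set X, (∀ i, MeasurableSet (A i)) →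
    Pairwise (fun i j => Disjoint (A i) (A j)) → iIndepFun (fun i ω => (N ω ∩ A i).encard) P

/-! ### The improper Poisson line process marked by speed-limits -/

/-- Lines of `ℝ^d` marked by a speed-limit in `(0, ∞)`. -/
abbrev MarkedLine (d : ℕ) : Type := LineSpace d × Ioi (0 : ℝ)

/-- The measure `(γ - 1) v^{-γ} dv` on the space `(0, ∞)` of speed-limits. -/
def speedMeasure (γ : ℝ) : Measure (Ioi (0 : ℝ)) :=
  ((volume : Measure ℝ).comap (Subtype.val : Ioi (0 : ℝ) → ℝ)).withDensity fun v =>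
    ENNReal.ofReal ((γ - 1) * (v : ℝ) ^ (-γ))

/-- The intensity measure `(γ - 1) v^{-γ} dv μ_d(dl)` on marked lines. -/
def markedLineIntensity (d : ℕ) (γ : ℝ) : Measure (MarkedLine d) :=
  (invariantLineMeasure d).prod (speedMeasure γ)

/-! ### Paths respecting the speed-limits -/

/-- The silhouette `S_v`: the union of all the lines with speed-limit at least `v`. -/
def silhouette {d : ℕ} (L : Set (MarkedLine d)) (v : ℝ) : Set (Euc d) :=
  {x | ∃ p ∈ L, v ≤ (p.2 : ℝ) ∧ x ∈ p.1.points}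

/-- The time interval `[0, T)`, where `T` may be infinite. -/
def timeInterval (T : EReal) : Set ℝ := {t | 0 ≤ t ∧ (t : EReal) < T}

/-- `ξ` is a `Π`-path up to the terminal time `T ∈ (0, ∞]`, where `L` is the realization of `Π`: it
is locally Lipschitz on `[0, T)` and, for each `v > 0`, at almost all times at which its speed
exceeds `v` it is on a line with speed-limit at least `v`. Values of `ξ` outside `[0, T)` are
irrelevant; a locally Lipschitz path is differentiable at almost all times. -/
structure IsPiPath {d : ℕ} (L : Set (MarkedLine d)) (T : EReal) (ξ : ℝ → Euc d) : Prop where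
  terminal_pos : 0 < T
  locallyLipschitzOn : LocallyLipschitzOn (timeInterval T) ξ
  speed_limit : ∀ v : ℝ, 0 < v →
    volume {t ∈ timeInterval T | v < ‖deriv ξ t‖ ∧ ξ t ∉ silhouette L v} = 0

/-- `ξ` is a `Π`-path which starts at `x₁` at time `0` and arrives at `x₂` at the finite
time `T`. -/
structure ConnectsInTime {d : ℕ} (L : Set (MarkedLine d)) (x₁ x₂ : Euc d) (T : ℝ)
    (ξ : ℝ → Euc d) : Prop where
  isPiPath : IsPiPath L (T : EReal) ξ
  continuousOn : ContinuousOn ξ (Icc 0 T)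
  start : ξ 0 = x₁
  finish : ξ T = x₂

end

/-!
Two points at distance `r` are connected recursively. With `α` small, look for a line which passes
within `α r` of both of them; travel along this line between its points near `x` and near `y`, and
solve in the same way the two remaining problems, each over a distance at most `α r`. At stage `n`
there are `2 ^ n` problems of size `r α ^ n`, and each gets the time `T / 4 ^ n`: a quarter of the
time for each of its two subproblems, and the middle half for the line. The speed needed at stage
`n` is then of order `(4 α) ^ n / T`. The total time left to the problems of stage `n` is
`T / 2 ^ n`, so almost all the time is spent on lines. The resulting limit path is Lipschitz since
`4 α ≤ 1`, and it respects the speed-limits almost everywhere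
(`IsRefinement.volume_violationTimes_le`, `IsRefinement.connectsInTime`).

The lines meeting two balls of radius of order `α r`, with centres at distance at most `2 r`, have
measure at least of order `r ^ (d - 1)` for fixed `α` (`exists_pos_le_invariantLineMeasure`), and the
speed-limits which are at least `v` have measure of order `v ^ (1 - γ)`. So at stage `n` the expected
number of suitable lines is at least a constant times `T ^ (γ - 1) q ^ (-n)`, with
`q = α ^ (γ - d) 4 ^ (γ - 1)`; since `γ > d`, a small `α` makes `q < 1` (`exists_scale_ratio`).
The probability that some pair of points in a bounded region lacks a suitable line at stage `n` is
estimated by a union bound over the centres of a covering by balls of radius of order `α ^ (n + 1)`.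
There are only exponentially many pairs of centres in `n`, while each fails with probability at most
`exp (-c T ^ (γ - 1) q ^ (-n))`. Hence the sum over all stages is finite and tends to `0` as
`T → ∞` (`ae_exists_fast_lines`). Only void probabilities of the Poisson process enter, and the path
is then built deterministically.
-/

/-! ### Coverings of balls -/

/-- A ball of a finite-dimensional space is covered by geometrically many balls of geometrically
small radius. One covering suffices: rescaled copies of it refine the balls of the previous stage. -/
theorem exists_finset_cover {E : Type*} [NormedAddCommGroup E] [NormedSpace ℝ E]
    [FiniteDimensional ℝ E] (R : ℝ) {ε α : ℝ} (hε : 0 < ε) (hα : 0 < α) (hα' : α ≤ 1) :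
    ∃ M : ℕ, ∀ n : ℕ, ∃ S : Finset E, S.card ≤ M ^ (n + 1) ∧
      ∀ x : E, ‖x‖ ≤ R → ∃ a ∈ S, dist x a < ε * α ^ n := by
  classical
  have : ProperSpace E := FiniteDimensional.proper ℝ E
  obtain ⟨t, ht, hcov⟩ := Metric.totallyBounded_iff.1
    (isCompact_closedBall (0 : E) (max R ε)).totallyBounded (ε * α) (by positivity)
  have hcov' : ∀ x : E, ‖x‖ ≤ max R ε → ∃ a ∈ ht.toFinset, dist x a < ε * α := by
    intro x hx
    have := hcov (mem_closedBall_zero_iff.2 hx)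
    simpa using this
  refine ⟨ht.toFinset.card, fun n => ?_⟩
  induction n with
  | zero =>
    refine ⟨ht.toFinset, by simp, fun x hx => ?_⟩
    obtain ⟨a, ha, hxa⟩ := hcov' x (hx.trans (le_max_left _ _))
    refine ⟨a, ha, hxa.trans_le ?_⟩
    rw [pow_zero]
    exact mul_le_mul_of_nonneg_left hα' hε.le
  | succ n ih =>
    obtain ⟨S, hS, hSc⟩ := ih
    refine ⟨Finset.image₂ (fun a z => a + α ^ n • z) S ht.toFinset, ?_, fun x hx => ?_⟩
    · rw [pow_succ]
      exact (Finset.card_image₂_le _ _ _).trans (Nat.mul_le_mul_right _ hS)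
    · have hn : 0 < α ^ n := pow_pos hα n
      obtain ⟨a, ha, hxa⟩ := hSc x hx
      obtain ⟨z, hz, hxz⟩ := hcov' ((α ^ n)⁻¹ • (x - a)) (by
        refine le_trans ?_ (le_max_right _ _)
        rw [norm_smul, norm_inv, Real.norm_of_nonneg hn.le, ← dist_eq_norm,
          inv_mul_le_iff₀ hn, mul_comm]
        exact hxa.le)
      refine ⟨_, Finset.mem_image₂_of_mem ha hz, ?_⟩
      have : x - (a + α ^ n • z) = α ^ n • ((α ^ n)⁻¹ • (x - a) - z) := by
        rw [smul_sub, smul_inv_smul₀ hn.ne', sub_sub]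
      rw [dist_eq_norm, this, norm_smul, Real.norm_of_nonneg hn.le, ← dist_eq_norm, pow_succ,
        mul_comm (α ^ n) α, ← mul_assoc, mul_comm]
      exact mul_lt_mul_of_pos_right hxz hn

/-! ### Void probabilities -/

/-- A Poisson process avoids a set of intensity at least `r` with probability at most `exp (-r)`. -/
theorem IsPoissonProcess.measure_inter_eq_empty_le {Ω X : Type*} [MeasurableSpace Ω]
    [MeasurableSpace X] {P : Measure Ω} {N : Ω → Set X} {Λ : Measure X}
    (h : IsPoissonProcess P N Λ) {A : Set X} (hA : MeasurableSet A) {r : ℝ}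
    (hr : ENNReal.ofReal r ≤ Λ A) :
    P {ω | N ω ∩ A = ∅} ≤ ENNReal.ofReal (Real.exp (-r)) := by
  have h0 : MeasurableSet ({0} : Set ℕ∞) := measurableSet_singleton 0
  have hset : {ω | N ω ∩ A = ∅} = (fun ω => (N ω ∩ A).encard) ⁻¹' {0} := by
    ext ω
    simp
  rw [hset, ← Measure.map_apply (h.measurable_count A hA) h0, h.map_count A hA, poissonLaw]
  split_ifs with htop
  · rw [Measure.dirac_apply' _ h0]
    simp
  · have hpre : (fun n : ℕ => (n : ℕ∞)) ⁻¹' {0} = {0} := by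
      ext n
      simp
    rw [Measure.map_apply (measurable_of_countable _) h0, hpre, poissonMeasure_singleton]
    refine ENNReal.ofReal_le_ofReal ?_
    have : r ≤ (Λ A).toNNReal := (ENNReal.ofReal_le_iff_le_toReal htop).1 hr
    simpa using this

/-! ### The speed-limit measure -/

instance sigmaFinite_comap_coe_Ioi :
    SigmaFinite ((volume : Measure ℝ).comap (Subtype.val : Ioi (0 : ℝ) → ℝ)) := by
  have hemb := MeasurableEmbedding.subtype_coe (measurableSet_Ioi (a := (0 : ℝ)))
  refine ⟨⟨⟨fun n => Subtype.val ⁻¹' Icc (0 : ℝ) n, fun _ => trivial, fun n => ?_, ?_⟩⟩⟩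
  · rw [hemb.comap_apply]
    exact (measure_mono (image_preimage_subset _ _)).trans_lt (by simp)
  · refine eq_univ_of_forall fun v => mem_iUnion.2 ?_
    obtain ⟨n, hn⟩ := exists_nat_ge (v : ℝ)
    exact ⟨n, v.2.le, hn⟩

instance sFinite_speedMeasure (γ : ℝ) : SFinite (speedMeasure γ) := by
  unfold speedMeasure
  infer_instance

theorem measurableSet_setOf_le_coe_Ioi (v : ℝ) : MeasurableSet {w : Ioi (0 : ℝ) | v ≤ w} :=
  measurableSet_le measurable_const measurable_subtype_coe

/-- The measure of `[v, ∞)` is exactly `v ^ (1 - γ)`; integrating over `[v, 2 v]` only gives this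
bound of the same order. -/
theorem le_speedMeasure_setOf_le {γ v : ℝ} (hγ : 1 < γ) (hv : 0 < v) :
    ENNReal.ofReal ((γ - 1) * 2 ^ (-γ) * v ^ (1 - γ)) ≤
      speedMeasure γ {w : Ioi (0 : ℝ) | v ≤ w} := by
  have hemb := MeasurableEmbedding.subtype_coe (measurableSet_Ioi (a := (0 : ℝ)))
  have hI : MeasurableSet (Subtype.val ⁻¹' Icc v (2 * v) : Set (Ioi (0 : ℝ))) :=
    measurable_subtype_coe measurableSet_Icc
  have hvol : (volume : Measure ℝ).comap (Subtype.val : Ioi (0 : ℝ) → ℝ)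
      (Subtype.val ⁻¹' Icc v (2 * v)) = ENNReal.ofReal v := by
    rw [hemb.comap_apply, Subtype.image_preimage_coe,
      inter_eq_right.2 (show Icc v (2 * v) ⊆ Ioi 0 from fun w hw => hv.trans_le hw.1),
      Real.volume_Icc]
    congr 1
    ring
  calc ENNReal.ofReal ((γ - 1) * 2 ^ (-γ) * v ^ (1 - γ))
      = ENNReal.ofReal ((γ - 1) * (2 * v) ^ (-γ)) * ENNReal.ofReal v := by
        rw [← ENNReal.ofReal_mul' hv.le, Real.mul_rpow zero_le_two hv.le,
          show 1 - γ = -γ + 1 by ring, Real.rpow_add hv, Real.rpow_one]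
        ring_nf
    _ = ∫⁻ _ in (Subtype.val ⁻¹' Icc v (2 * v) : Set (Ioi (0 : ℝ))),
          ENNReal.ofReal ((γ - 1) * (2 * v) ^ (-γ))
          ∂(volume : Measure ℝ).comap (Subtype.val : Ioi (0 : ℝ) → ℝ) := by
        rw [setLIntegral_const, hvol]
    _ ≤ ∫⁻ w in (Subtype.val ⁻¹' Icc v (2 * v) : Set (Ioi (0 : ℝ))),
          ENNReal.ofReal ((γ - 1) * (w : ℝ) ^ (-γ))
          ∂(volume : Measure ℝ).comap (Subtype.val : Ioi (0 : ℝ) → ℝ) := by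
        refine setLIntegral_mono' hI fun w hw => ENNReal.ofReal_le_ofReal ?_
        exact mul_le_mul_of_nonneg_left
          (Real.rpow_le_rpow_of_nonpos w.2 hw.2 (by linarith)) (by linarith)
    _ = speedMeasure γ (Subtype.val ⁻¹' Icc v (2 * v)) := by
        rw [speedMeasure, withDensity_apply _ hI]
    _ ≤ _ := measure_mono fun w hw => hw.1

/-! ### Lines hitting two balls -/

/-- The lines which meet the set `B`. -/
def linesHitting {d : ℕ} (B : Set (Euc d)) : Set (LineSpace d) := {l | (l.points ∩ B).Nonempty}

theorem add_smul_mem_points_lineThrough {d : ℕ} (x : Euc d) (u : Metric.sphere (0 : Euc d) 1)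
    {w : Euc d} (hw : w ∈ Submodule.span ℝ {(u : Euc d)}) :
    w + x ∈ (lineThrough (x, u)).points := by
  simpa [LineSpace.points, lineThrough, AffineSubspace.mem_mk'] using hw

theorem measurableSet_linesHitting {d : ℕ} {B : Set (Euc d)} (hB : IsOpen B) :
    MeasurableSet (linesHitting B) := by
  have : lineThrough (d := d) ⁻¹' linesHitting B =
      ⋃ t : ℝ, {p | t • (p.2 : Euc d) + p.1 ∈ B} := by
    ext ⟨x, u⟩
    simp only [linesHitting, mem_preimage, mem_iUnion]
    constructor
    · rintro ⟨z, hz, hzB⟩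
      have hz' : z - x ∈ Submodule.span ℝ {(u : Euc d)} := by
        simpa [LineSpace.points, lineThrough, AffineSubspace.mem_mk'] using hz
      obtain ⟨t, ht⟩ := Submodule.mem_span_singleton.1 hz'
      refine ⟨t, ?_⟩
      change t • (u : Euc d) + x ∈ B
      rwa [ht, sub_add_cancel]
    · rintro ⟨t, ht⟩
      exact ⟨_, add_smul_mem_points_lineThrough x u
        (Submodule.smul_mem _ t (Submodule.mem_span_singleton_self _)), ht⟩
  refine MeasurableSpace.map_def.2 ?_
  rw [this]
  refine (isOpen_iUnion fun t => hB.preimage ?_).measurableSet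
  fun_prop

open scoped Pointwise in
/-- The cone over the cap contains a ball of fixed radius about `2⁻¹ • e`, so the spherical measure
of a cap is bounded below independently of its centre. -/
theorem exists_pos_le_toSphere_cap (d : ℕ) (hd : 1 ≤ d) {η : ℝ} (hη : 0 < η) :
    ∃ c : ℝ≥0∞, c ≠ 0 ∧ ∀ e : Euc d, ‖e‖ = 1 →
      c ≤ (volume : Measure (Euc d)).toSphere {u | ‖(u : Euc d) - e‖ < η} := by
  set ε : ℝ := min (1 / 4) (η / 8)
  have hε : 0 < ε := by positivity
  have hε4 : ε ≤ 1 / 4 := min_le_left _ _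
  have hε8 : ε ≤ η / 8 := min_le_right _ _
  refine ⟨volume (Metric.ball (0 : Euc d) ε), (Metric.measure_ball_pos _ _ hε).ne', fun e he => ?_⟩
  have hmeas : MeasurableSet {u : Metric.sphere (0 : Euc d) 1 | ‖(u : Euc d) - e‖ < η} := by
    refine (isOpen_lt ?_ continuous_const).measurableSet
    fun_prop
  have hsub : Metric.ball ((2 : ℝ)⁻¹ • e) ε ⊆
      Ioo (0 : ℝ) 1 • (Subtype.val '' {u : Metric.sphere (0 : Euc d) 1 | ‖(u : Euc d) - e‖ < η}) := by
    intro z hz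
    rw [mem_ball_iff_norm] at hz
    have hhalf : ‖(2 : ℝ)⁻¹ • e‖ = 1 / 2 := by rw [norm_smul, he]; norm_num
    have habs := (abs_norm_sub_norm_le z ((2 : ℝ)⁻¹ • e)).trans_lt hz
    rw [hhalf, abs_lt] at habs
    have hz0 : 1 / 4 < ‖z‖ := by linarith
    have hzpos : 0 < ‖z‖ := by linarith
    refine ⟨‖z‖, ⟨hzpos, by linarith⟩, ‖z‖⁻¹ • z, ⟨⟨‖z‖⁻¹ • z, ?_⟩, ?_, rfl⟩, ?_⟩
    · rw [mem_sphere_zero_iff_norm, norm_smul, norm_inv, norm_norm, inv_mul_cancel₀ hzpos.ne']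
    · change ‖‖z‖⁻¹ • z - e‖ < η
      have h1 : ‖z‖⁻¹ • z - e = ‖z‖⁻¹ • (z - ‖z‖ • e) := by
        rw [smul_sub, inv_smul_smul₀ hzpos.ne']
      have h2 : ‖z - ‖z‖ • e‖ < 2 * ε := by
        have h3 : z - ‖z‖ • e = (z - (2 : ℝ)⁻¹ • e) + (2⁻¹ - ‖z‖) • e := by
          rw [sub_smul]; abel
        have h4 : ‖(2⁻¹ - ‖z‖) • e‖ < ε := by
          rw [norm_smul, he, mul_one, Real.norm_eq_abs, abs_lt]
          constructor <;> linarith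
        rw [h3]
        linarith [norm_add_le (z - (2 : ℝ)⁻¹ • e) ((2⁻¹ - ‖z‖) • e)]
      rw [h1, norm_smul, norm_inv, norm_norm, inv_mul_lt_iff₀ hzpos]
      have h5 := mul_lt_mul_of_pos_right hz0 hη
      linarith
    · exact smul_inv_smul₀ hzpos.ne' z
  rw [Measure.toSphere_apply' _ hmeas, finrank_euclideanSpace_fin,
    ← Measure.addHaar_ball_center volume ((2 : ℝ)⁻¹ • e) ε]
  refine (measure_mono hsub).trans (le_mul_of_one_le_left zero_le ?_)
  exact_mod_cast hd

/-- A line through a point of the `(d - 1)`-dimensional ball of radius `δ r / 2` about the projection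
of `a`, with direction within `δ / 4` of that of `b - a`, meets both balls. -/
theorem exists_pos_le_invariantLineMeasure (d : ℕ) (hd : 2 ≤ d) {δ : ℝ} (hδ : 0 < δ) :
    ∃ c : ℝ, 0 < c ∧ ∀ (r : ℝ) (a b : Euc d), 0 < r → ‖b - a‖ ≤ 2 * r →
      ENNReal.ofReal (c * r ^ (d - 1)) ≤ invariantLineMeasure d
        (linesHitting (Metric.ball a (δ * r)) ∩ linesHitting (Metric.ball b (δ * r))) := by
  obtain ⟨c₁, hc₁, hcap⟩ := exists_pos_le_toSphere_cap d (by omega) (η := δ / 4) (by positivity)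
  set c₂ : ℝ≥0∞ := ENNReal.ofReal (√Real.pi ^ (d - 1) / Real.Gamma ((d - 1 : ℕ) / 2 + 1)) with hc₂
  have hc₂0 : c₂ ≠ 0 := by
    rw [hc₂, ENNReal.ofReal_ne_zero_iff]
    have : 0 < Real.Gamma ((d - 1 : ℕ) / 2 + 1) := Real.Gamma_pos_of_pos (by positivity)
    positivity
  have hκ : (2 * unitBallVolume (d - 1))⁻¹ ≠ 0 :=
    ENNReal.inv_ne_zero.2 (ENNReal.mul_ne_top ENNReal.ofNat_ne_top measure_ball_lt_top.ne)
  set C : ℝ≥0∞ := (2 * unitBallVolume (d - 1))⁻¹ * (c₂ * c₁) * ENNReal.ofReal ((δ / 2) ^ (d - 1))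
  have hC : C ≠ 0 := by
    refine mul_ne_zero (mul_ne_zero hκ (mul_ne_zero hc₂0 hc₁)) ?_
    rw [ENNReal.ofReal_ne_zero_iff]
    positivity
  -- The constant is made finite, since its finiteness is not needed otherwise.
  have hC1 : min C 1 ≠ ∞ := (min_le_right _ _).trans_lt ENNReal.one_lt_top |>.ne
  refine ⟨(min C 1).toReal, ENNReal.toReal_pos (by simp [hC]) hC1, fun r a b hr hab => ?_⟩
  obtain ⟨e, he, hbe⟩ : ∃ e : Euc d, ‖e‖ = 1 ∧ b - a = ‖b - a‖ • e := by
    rcases eq_or_ne (b - a) 0 with h0 | h0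
    · have : Nontrivial (Euc d) :=
        Module.nontrivial_of_finrank_pos (R := ℝ) (by rw [finrank_euclideanSpace_fin]; omega)
      obtain ⟨e, he⟩ := exists_norm_eq (Euc d) zero_le_one
      exact ⟨e, he, by simp [h0]⟩
    · have hpos : ‖b - a‖ ≠ 0 := norm_ne_zero_iff.2 h0
      exact ⟨‖b - a‖⁻¹ • (b - a), by rw [norm_smul, norm_inv, norm_norm, inv_mul_cancel₀ hpos],
        (smul_inv_smul₀ hpos _).symm⟩
  set A := linesHitting (Metric.ball a (δ * r)) ∩ linesHitting (Metric.ball b (δ * r))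
  have hA : MeasurableSet A :=
    (measurableSet_linesHitting Metric.isOpen_ball).inter
      (measurableSet_linesHitting Metric.isOpen_ball)
  set cap := {u : Metric.sphere (0 : Euc d) 1 | ‖(u : Euc d) - e‖ < δ / 4}
  have hcapm : MeasurableSet cap := by
    refine (isOpen_lt ?_ continuous_const).measurableSet
    fun_prop
  have hfibre : ∀ u ∈ cap, ENNReal.ofReal (δ / 2 * r) ^ (d - 1) * c₂ ≤
      volume {y : (Submodule.span ℝ {(u : Euc d)})ᗮ | lineThrough ((y : Euc d), u) ∈ A} := by
    intro u hu
    have hu1 : ‖(u : Euc d)‖ = 1 := norm_eq_of_mem_sphere u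
    set s : Submodule ℝ (Euc d) := Submodule.span ℝ {(u : Euc d)} with hs
    have hrank : Module.finrank ℝ sᗮ = d - 1 := by
      have : Fact (Module.finrank ℝ (Euc d) = (d - 1) + 1) :=
        ⟨by rw [finrank_euclideanSpace_fin]; omega⟩
      exact Submodule.finrank_orthogonal_span_singleton (ne_zero_of_mem_unit_sphere u)
    have : Nontrivial sᗮ := Module.nontrivial_of_finrank_pos (R := ℝ) (by rw [hrank]; omega)
    have hball := InnerProductSpace.volume_ball (sᗮ.orthogonalProjectionOnto a) (δ / 2 * r)
    rw [hrank] at hball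
    rw [hc₂, ← hball]
    refine measure_mono fun y hy => ?_
    set w : Euc d := a - sᗮ.orthogonalProjectionOnto a with hw
    have hws : w ∈ s := by
      have h1 : w ∈ sᗮᗮ := sᗮ.sub_starProjection_mem_orthogonal a
      rwa [Submodule.orthogonal_orthogonal] at h1
    have hya : ‖w + y - a‖ < δ / 2 * r := by
      rw [mem_ball_iff_norm] at hy
      have : w + y - a = ((y - sᗮ.orthogonalProjectionOnto a : sᗮ) : Euc d) := by
        rw [hw, Submodule.coe_sub]; abel
      rw [this]
      exact hy
    have hδr : 0 < δ * r := mul_pos hδ hr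
    refine ⟨⟨w + y, add_smul_mem_points_lineThrough _ _ hws, ?_⟩,
      ⟨(w + ‖b - a‖ • (u : Euc d)) + y, add_smul_mem_points_lineThrough _ _
        (add_mem hws (Submodule.smul_mem _ _ (Submodule.mem_span_singleton_self _))), ?_⟩⟩
    · rw [mem_ball_iff_norm]
      linarith
    · rw [mem_ball_iff_norm]
      have h1 : w + ‖b - a‖ • (u : Euc d) + y - b =
          (w + y - a) + ‖b - a‖ • ((u : Euc d) - e) := by
        rw [smul_sub, ← hbe]; abel
      have h2 : ‖‖b - a‖ • ((u : Euc d) - e)‖ ≤ 2 * r * (δ / 4) := by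
        rw [norm_smul, norm_norm]
        exact mul_le_mul hab (le_of_lt hu) (norm_nonneg _) (by positivity)
      rw [h1]
      linarith [norm_add_le (w + y - a) (‖b - a‖ • ((u : Euc d) - e))]
  calc ENNReal.ofReal ((min C 1).toReal * r ^ (d - 1))
      = min C 1 * ENNReal.ofReal (r ^ (d - 1)) := by
        rw [ENNReal.ofReal_mul ENNReal.toReal_nonneg, ENNReal.ofReal_toReal hC1]
    _ ≤ C * ENNReal.ofReal (r ^ (d - 1)) := mul_le_mul_left (min_le_left _ _) _
    _ = (2 * unitBallVolume (d - 1))⁻¹ * ((ENNReal.ofReal (δ / 2 * r) ^ (d - 1) * c₂) * c₁) := by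
        rw [← ENNReal.ofReal_pow (by positivity), mul_pow, ENNReal.ofReal_mul (by positivity)]
        ring
    _ ≤ (2 * unitBallVolume (d - 1))⁻¹ * ((ENNReal.ofReal (δ / 2 * r) ^ (d - 1) * c₂) *
          (volume : Measure (Euc d)).toSphere cap) := by
        gcongr
        exact hcap e he
    _ ≤ invariantLineMeasure d A := by
        rw [invariantLineMeasure_apply d hA, ← setLIntegral_const]
        refine mul_le_mul_right ?_ _
        exact (setLIntegral_mono' hcapm hfibre).trans (setLIntegral_le_lintegral _ _)

/-! ### Paths built by recursive refinement -/

section Refinement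

variable {E : Type*} [NormedAddCommGroup E]

theorem norm_sub_le_glue {f : ℝ → E} {a b c K : ℝ}
    (h₁ : ∀ s t, a ≤ s → s ≤ t → t ≤ b → ‖f t - f s‖ ≤ K * (t - s))
    (h₂ : ∀ s t, b ≤ s → s ≤ t → t ≤ c → ‖f t - f s‖ ≤ K * (t - s)) :
    ∀ s t, a ≤ s → s ≤ t → t ≤ c → ‖f t - f s‖ ≤ K * (t - s) := by
  intro s t has hst htc
  rcases le_total t b with htb | hbt
  · exact h₁ s t has hst htb
  rcases le_total b s with hbs | hsb
  · exact h₂ s t hbs hst htc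
  calc ‖f t - f s‖ = ‖(f t - f b) + (f b - f s)‖ := by rw [sub_add_sub_cancel]
    _ ≤ ‖f t - f b‖ + ‖f b - f s‖ := norm_add_le _ _
    _ ≤ K * (t - b) + K * (b - s) := add_le_add (h₂ b t le_rfl hbt htc) (h₁ s b has hsb le_rfl)
    _ = K * (t - s) := by ring

variable [NormedSpace ℝ E]

/-- A rule which refines every admissible connection problem "go from `x` to `y` at level `n`" into
two such problems at level `n + 1`, from `x` to `p n x y` and from `q n x y` to `y`, separated by
the segment from `p n x y` to `q n x y`. Distances at level `n` are of order `α ^ n`. The factor `2`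
in `middle` is there because the segment is given half of the available time. -/
structure IsRefinement (K α : ℝ) (good : ℕ → E → E → Prop) (p q : ℕ → E → E → E) : Prop where
  near : ∀ {n x y}, good n x y → ‖y - x‖ ≤ K * α ^ n
  left : ∀ {n x y}, good n x y → good (n + 1) x (p n x y)
  right : ∀ {n x y}, good n x y → good (n + 1) (q n x y) y
  middle : ∀ {n x y}, good n x y → 2 * ‖q n x y - p n x y‖ ≤ K * α ^ n

/-- The path on `[0, 1]` from `x` to `y` obtained by refining `N` times from level `n` on, and then
joining by straight segments: the first and last quarters of the time interval are spent on the two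
subproblems, and the middle half on the segment between them. -/
noncomputable def refinedPath (p q : ℕ → E → E → E) : ℕ → ℕ → E → E → ℝ → E
  | 0, _, x, y, s => AffineMap.lineMap x y s
  | N + 1, n, x, y, s =>
    if s ≤ 1 / 4 then refinedPath p q N (n + 1) x (p n x y) (4 * s)
    else if s ≤ 3 / 4 then AffineMap.lineMap (p n x y) (q n x y) (2 * s - 1 / 2)
    else refinedPath p q N (n + 1) (q n x y) y (4 * s - 3)

/-- The limit of `refinedPath` as the number of refinements tends to infinity. -/
noncomputable def limitPath (p q : ℕ → E → E → E) (n : ℕ) (x y : E) (s : ℝ) : E :=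
  limUnder atTop fun N => refinedPath p q N n x y s

variable {K α : ℝ} {good : ℕ → E → E → Prop} {p q : ℕ → E → E → E}

@[simp] theorem refinedPath_zero_right (p q : ℕ → E → E → E) (N n : ℕ) (x y : E) :
    refinedPath p q N n x y 0 = x := by
  induction N generalizing n x y with
  | zero => simp [refinedPath]
  | succ N ih => rw [refinedPath, if_pos (by norm_num), mul_zero, ih]

@[simp] theorem refinedPath_one_right (p q : ℕ → E → E → E) (N n : ℕ) (x y : E) :
    refinedPath p q N n x y 1 = y := by
  induction N generalizing n x y with
  | zero => simp [refinedPath]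
  | succ N ih =>
    rw [refinedPath, if_neg (by norm_num), if_neg (by norm_num)]
    convert ih (n + 1) (q n x y) y using 2
    norm_num

theorem refinedPath_succ_left (N n : ℕ) (x y : E) {s : ℝ} (hs : s ≤ 1 / 4) :
    refinedPath p q (N + 1) n x y s = refinedPath p q N (n + 1) x (p n x y) (4 * s) := by
  rw [refinedPath, if_pos hs]

theorem refinedPath_succ_middle (N n : ℕ) (x y : E) {s : ℝ} (hs : 1 / 4 ≤ s) (hs' : s ≤ 3 / 4) :
    refinedPath p q (N + 1) n x y s =
      AffineMap.lineMap (p n x y) (q n x y) (2 * s - 1 / 2) := by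
  rcases hs.eq_or_lt with rfl | hs
  · rw [refinedPath_succ_left _ _ _ _ le_rfl]
    norm_num
  · rw [refinedPath, if_neg hs.not_ge, if_pos hs']

theorem refinedPath_succ_right (N n : ℕ) (x y : E) {s : ℝ} (hs : 3 / 4 ≤ s) :
    refinedPath p q (N + 1) n x y s = refinedPath p q N (n + 1) (q n x y) y (4 * s - 3) := by
  rcases hs.eq_or_lt with rfl | hs
  · rw [refinedPath_succ_middle _ _ _ _ (by norm_num) le_rfl]
    norm_num
  · rw [refinedPath, if_neg (by linarith), if_neg hs.not_ge]

theorem IsRefinement.norm_refinedPath_sub_le (h : IsRefinement K α good p q) (hK : 0 ≤ K)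
    (hα : 0 ≤ α) (hα' : α ≤ 1 / 4) (N : ℕ) {n : ℕ} {x y : E} (hxy : good n x y) :
    ∀ s t, 0 ≤ s → s ≤ t → t ≤ 1 →
      ‖refinedPath p q N n x y t - refinedPath p q N n x y s‖ ≤ K * α ^ n * (t - s) := by
  have hKα : ∀ n, 0 ≤ K * α ^ n := fun n => by positivity
  have key : ∀ (u v : E) (a b : ℝ), a ≤ b →
      ‖AffineMap.lineMap u v b - AffineMap.lineMap u v a‖ = ‖v - u‖ * (b - a) := by
    intro u v a b hab
    rw [← dist_eq_norm, dist_lineMap_lineMap, Real.dist_eq, abs_of_nonneg (sub_nonneg.2 hab),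
      dist_comm, dist_eq_norm, mul_comm]
  induction N generalizing n x y with
  | zero =>
    intro s t _ hst _
    simp only [refinedPath]
    rw [key x y s t hst]
    exact mul_le_mul_of_nonneg_right (h.near hxy) (sub_nonneg.2 hst)
  | succ N ih =>
    -- Running four times faster through a path whose Lipschitz constant is four times smaller.
    have hle : ∀ {z : ℝ}, 0 ≤ z → K * α ^ (n + 1) * (4 * z) ≤ K * α ^ n * z := by
      intro z hz
      have := mul_le_mul_of_nonneg_left hα' (mul_nonneg (hKα n) hz)
      rw [pow_succ]
      linarith
    refine norm_sub_le_glue (b := 1 / 4) ?_ (norm_sub_le_glue (b := 3 / 4) ?_ ?_)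
    · intro s t hs hst ht
      rw [refinedPath_succ_left _ _ _ _ ht, refinedPath_succ_left _ _ _ _ (hst.trans ht)]
      refine (ih (h.left hxy) _ _ (by linarith) (by linarith) (by linarith)).trans ?_
      rw [← mul_sub]
      exact hle (sub_nonneg.2 hst)
    · intro s t hs hst ht
      rw [refinedPath_succ_middle _ _ _ _ (hs.trans hst) ht,
        refinedPath_succ_middle _ _ _ _ hs (hst.trans ht), key _ _ _ _ (by linarith)]
      have := mul_le_mul_of_nonneg_right (h.middle hxy) (sub_nonneg.2 hst)
      linarith
    · intro s t hs hst ht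
      rw [refinedPath_succ_right _ _ _ _ (hs.trans hst), refinedPath_succ_right _ _ _ _ hs]
      refine (ih (h.right hxy) _ _ (by linarith) (by linarith) (by linarith)).trans ?_
      refine le_of_eq_of_le ?_ (hle (sub_nonneg.2 hst))
      ring

theorem IsRefinement.dist_refinedPath_succ_le (h : IsRefinement K α good p q) (hK : 0 ≤ K)
    (hα : 0 ≤ α) (hα' : α ≤ 1 / 4) (N : ℕ) {n : ℕ} {x y : E} (hxy : good n x y) {s : ℝ}
    (hs : s ∈ Icc (0 : ℝ) 1) :
    dist (refinedPath p q N n x y s) (refinedPath p q (N + 1) n x y s) ≤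
      2 * K * α ^ n * α ^ N := by
  obtain ⟨hs0, hs1⟩ := hs
  have hKα : ∀ n, 0 ≤ K * α ^ n := fun n => by positivity
  induction N generalizing n x y s with
  | zero =>
    have h1 := h.norm_refinedPath_sub_le hK hα hα' 0 hxy 0 s le_rfl hs0 hs1
    have h2 := h.norm_refinedPath_sub_le hK hα hα' 1 hxy 0 s le_rfl hs0 hs1
    rw [refinedPath_zero_right, ← dist_eq_norm] at h1 h2
    have h3 := mul_le_mul_of_nonneg_left hs1 (hKα n)
    have := dist_triangle_right (refinedPath p q 0 n x y s) (refinedPath p q (0 + 1) n x y s) x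
    simp only [zero_add, sub_zero, pow_zero] at *
    linarith
  | succ N ih =>
    have e : 2 * K * α ^ (n + 1) * α ^ N = 2 * K * α ^ n * α ^ (N + 1) := by ring
    rcases le_total s (1 / 4) with h1 | h1
    · rw [refinedPath_succ_left _ _ _ _ h1, refinedPath_succ_left _ _ _ _ h1, ← e]
      exact ih (h.left hxy) (by linarith) (by linarith)
    rcases le_total s (3 / 4) with h2 | h2
    · rw [refinedPath_succ_middle _ _ _ _ h1 h2, refinedPath_succ_middle _ _ _ _ h1 h2, dist_self]
      positivity
    · rw [refinedPath_succ_right _ _ _ _ h2, refinedPath_succ_right _ _ _ _ h2, ← e]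
      exact ih (h.right hxy) (by linarith) (by linarith)

theorem limitPath_zero_right (p q : ℕ → E → E → E) (n : ℕ) (x y : E) :
    limitPath p q n x y 0 = x := by
  simpa [limitPath] using (tendsto_const_nhds (x := x) (f := atTop (α := ℕ))).limUnder_eq

theorem limitPath_one_right (p q : ℕ → E → E → E) (n : ℕ) (x y : E) :
    limitPath p q n x y 1 = y := by
  simpa [limitPath] using (tendsto_const_nhds (x := y) (f := atTop (α := ℕ))).limUnder_eq

variable [CompleteSpace E]

theorem IsRefinement.tendsto_limitPath (h : IsRefinement K α good p q) (hK : 0 ≤ K)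
    (hα : 0 ≤ α) (hα' : α ≤ 1 / 4) {n : ℕ} {x y : E} (hxy : good n x y) {s : ℝ}
    (hs : s ∈ Icc (0 : ℝ) 1) :
    Tendsto (fun N => refinedPath p q N n x y s) atTop (𝓝 (limitPath p q n x y s)) :=
  (cauchySeq_of_le_geometric α (2 * K * α ^ n) (by linarith) fun N =>
    h.dist_refinedPath_succ_le hK hα hα' N hxy hs).tendsto_limUnder

theorem IsRefinement.lipschitzOnWith_limitPath (h : IsRefinement K α good p q) (hK : 0 ≤ K)
    (hα : 0 ≤ α) (hα' : α ≤ 1 / 4) {n : ℕ} {x y : E} (hxy : good n x y) :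
    LipschitzOnWith (K * α ^ n).toNNReal (limitPath p q n x y) (Icc 0 1) := by
  have hle : ∀ s t, s ∈ Icc (0 : ℝ) 1 → t ∈ Icc (0 : ℝ) 1 → s ≤ t →
      dist (limitPath p q n x y t) (limitPath p q n x y s) ≤ K * α ^ n * (t - s) := by
    intro s t hs ht hst
    refine le_of_tendsto ((h.tendsto_limitPath hK hα hα' hxy ht).dist
      (h.tendsto_limitPath hK hα hα' hxy hs)) (Eventually.of_forall fun N => ?_)
    rw [dist_eq_norm]
    exact h.norm_refinedPath_sub_le hK hα hα' N hxy s t hs.1 hst ht.2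
  refine LipschitzOnWith.of_dist_le_mul fun s hs t ht => ?_
  rw [Real.coe_toNNReal _ (by positivity)]
  rcases le_total s t with hst | hst
  · rw [dist_comm, dist_comm s, Real.dist_eq, abs_of_nonneg (sub_nonneg.2 hst)]
    exact hle s t hs ht hst
  · rw [Real.dist_eq, abs_of_nonneg (sub_nonneg.2 hst)]
    exact hle t s ht hs hst

theorem IsRefinement.limitPath_left (h : IsRefinement K α good p q) (hK : 0 ≤ K)
    (hα : 0 ≤ α) (hα' : α ≤ 1 / 4) {n : ℕ} {x y : E} (hxy : good n x y) {s : ℝ}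
    (hs : 0 ≤ s) (hs' : s ≤ 1 / 4) :
    limitPath p q n x y s = limitPath p q (n + 1) x (p n x y) (4 * s) := by
  refine tendsto_nhds_unique ((tendsto_add_atTop_iff_nat 1).2
    (h.tendsto_limitPath hK hα hα' hxy ⟨hs, by linarith⟩)) ?_
  simp only [refinedPath_succ_left _ _ _ _ hs']
  exact h.tendsto_limitPath hK hα hα' (h.left hxy) ⟨by linarith, by linarith⟩

theorem IsRefinement.limitPath_middle (h : IsRefinement K α good p q) (hK : 0 ≤ K)
    (hα : 0 ≤ α) (hα' : α ≤ 1 / 4) {n : ℕ} {x y : E} (hxy : good n x y) {s : ℝ}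
    (hs : 1 / 4 ≤ s) (hs' : s ≤ 3 / 4) :
    limitPath p q n x y s = AffineMap.lineMap (p n x y) (q n x y) (2 * s - 1 / 2) := by
  refine tendsto_nhds_unique ((tendsto_add_atTop_iff_nat 1).2
    (h.tendsto_limitPath hK hα hα' hxy ⟨by linarith, by linarith⟩)) ?_
  simp only [refinedPath_succ_middle _ _ _ _ hs hs']
  exact tendsto_const_nhds

theorem IsRefinement.limitPath_right (h : IsRefinement K α good p q) (hK : 0 ≤ K)
    (hα : 0 ≤ α) (hα' : α ≤ 1 / 4) {n : ℕ} {x y : E} (hxy : good n x y) {s : ℝ}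
    (hs : 3 / 4 ≤ s) (hs' : s ≤ 1) :
    limitPath p q n x y s = limitPath p q (n + 1) (q n x y) y (4 * s - 3) := by
  refine tendsto_nhds_unique ((tendsto_add_atTop_iff_nat 1).2
    (h.tendsto_limitPath hK hα hα' hxy ⟨by linarith, by linarith⟩)) ?_
  simp only [refinedPath_succ_right _ _ _ _ hs]
  exact h.tendsto_limitPath hK hα hα' (h.right hxy) ⟨by linarith, by linarith⟩

end Refinement

/-! ### Speed-limits along refined paths -/

section SpeedLimit

variable {d : ℕ} {K α T : ℝ} {good : ℕ → Euc d → Euc d → Prop} {p q : ℕ → Euc d → Euc d → Euc d}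
  {L : Set (MarkedLine d)}

/-- The times in `(0, 1)` at which the path `f`, run `c` times faster, breaks a speed-limit. -/
def violationTimes (L : Set (MarkedLine d)) (c : ℝ) (f : ℝ → Euc d) : Set ℝ :=
  {s ∈ Ioo (0 : ℝ) 1 | ∃ v : ℝ, 0 < v ∧ v < c * ‖deriv f s‖ ∧ f s ∉ silhouette L v}

/-- If every middle segment lies on a line which is fast enough, then violations can only occur in
the subproblems, so their total measure is halved by each refinement. -/
theorem IsRefinement.volume_violationTimes_le (h : IsRefinement K α good p q) (hK : 0 ≤ K)
    (hα : 0 ≤ α) (hα' : α ≤ 1 / 4) (hT : 0 < T)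
    (hline : ∀ {n x y}, good n x y → ∃ m ∈ L, K * (4 * α) ^ n / T ≤ (m.2 : ℝ) ∧
      p n x y ∈ m.1.points ∧ q n x y ∈ m.1.points)
    (N : ℕ) {n : ℕ} {x y : Euc d} (hxy : good n x y) :
    volume (violationTimes L (4 ^ n / T) (limitPath p q n x y)) ≤ 2⁻¹ ^ N := by
  induction N generalizing n x y with
  | zero =>
    refine (measure_mono (t := Ioo (0 : ℝ) 1) fun s hs => hs.1).trans ?_
    simp
  | succ N ih =>
    set f := limitPath p q n x y with hf
    set f₁ := limitPath p q (n + 1) x (p n x y)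
    set f₂ := limitPath p q (n + 1) (q n x y) y
    have hsub : violationTimes L (4 ^ n / T) f ⊆
        ((fun s => 4 * s) ⁻¹' violationTimes L (4 ^ (n + 1) / T) f₁ ∪
          (fun s => 4 * s) ⁻¹' ((fun s => s + -3) ⁻¹' violationTimes L (4 ^ (n + 1) / T) f₂)) ∪
        {1 / 4, 3 / 4} := by
      rintro s ⟨⟨hs0, hs1⟩, v, hv, hvs, hsil⟩
      have hsc : ∀ z : Euc d, 4 ^ n / T * ‖(4 : ℝ) • z‖ = 4 ^ (n + 1) / T * ‖z‖ := by
        intro z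
        rw [norm_smul, pow_succ]
        norm_num
        ring
      rcases lt_trichotomy s (1 / 4) with h1 | h1 | h1
      · left; left
        have heq : f =ᶠ[𝓝 s] fun s => f₁ (4 * s) := by
          filter_upwards [Ioo_mem_nhds hs0 h1] with t ht
          exact h.limitPath_left hK hα hα' hxy ht.1.le ht.2.le
        rw [heq.deriv_eq, deriv_comp_mul_left, hsc] at hvs
        rw [heq.eq_of_nhds] at hsil
        exact ⟨⟨by linarith, by linarith⟩, v, hv, hvs, hsil⟩
      · right; left; exact h1
      rcases lt_trichotomy s (3 / 4) with h2 | h2 | h2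
      · exfalso
        have heq : f =ᶠ[𝓝 s] fun s => AffineMap.lineMap (p n x y) (q n x y) (2 * s - 1 / 2) := by
          filter_upwards [Ioo_mem_nhds h1 h2] with t ht
          exact h.limitPath_middle hK hα hα' hxy ht.1.le ht.2.le
        have hder : HasDerivAt
            (fun s : ℝ => (AffineMap.lineMap (p n x y) (q n x y) (2 * s - 1 / 2) : Euc d))
            ((2 : ℝ) • (q n x y - p n x y)) s := by
          have h3 : HasDerivAt (fun s : ℝ => 2 * s - 1 / 2) 2 s := by
            simpa using ((hasDerivAt_id s).const_mul 2).sub_const (1 / 2)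
          exact AffineMap.hasDerivAt_lineMap.scomp s h3
        obtain ⟨m, hm, hspeed, hp, hq⟩ := hline hxy
        rw [heq.deriv_eq, hder.deriv, norm_smul, Real.norm_ofNat] at hvs
        rw [heq.eq_of_nhds] at hsil
        refine hsil ⟨m, hm, ?_, AffineMap.lineMap_mem _ hp hq⟩
        have h4 : 4 ^ n / T * (2 * ‖q n x y - p n x y‖) ≤ 4 ^ n / T * (K * α ^ n) :=
          mul_le_mul_of_nonneg_left (h.middle hxy) (by positivity)
        have h5 : 4 ^ n / T * (K * α ^ n) = K * (4 * α) ^ n / T := by rw [mul_pow]; ring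
        linarith
      · right; right; exact h2
      · left; right
        have heq : f =ᶠ[𝓝 s] fun s => f₂ (4 * s - 3) := by
          filter_upwards [Ioo_mem_nhds h2 hs1] with t ht
          exact h.limitPath_right hK hα hα' hxy ht.1.le ht.2.le
        have hder : deriv (fun s => f₂ (4 * s - 3)) s = (4 : ℝ) • deriv f₂ (4 * s - 3) := by
          rw [deriv_comp_mul_left 4 (fun s => f₂ (s - 3)), deriv_comp_sub_const]
        rw [heq.deriv_eq, hder, hsc] at hvs
        rw [heq.eq_of_nhds] at hsil
        simp only [sub_eq_add_neg] at hvs hsil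
        exact ⟨⟨by simp only; linarith, by simp only; linarith⟩, v, hv, hvs, hsil⟩
    have hpair : volume ({1 / 4, 3 / 4} : Set ℝ) = 0 := (Set.toFinite _).measure_zero _
    refine (measure_mono hsub).trans ((measure_union_le _ _).trans ?_)
    rw [hpair, add_zero]
    refine (measure_union_le _ _).trans ?_
    rw [Real.volume_preimage_mul_left four_ne_zero, Real.volume_preimage_mul_left four_ne_zero,
      measure_preimage_add_right, ← mul_add]
    refine (mul_le_mul_right (add_le_add (ih (h.left hxy)) (ih (h.right hxy))) _).trans
      (le_of_eq ?_)
    have h6 : ENNReal.ofReal |(4 : ℝ)⁻¹| * 2 = 2⁻¹ := by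
      rw [show (2 : ℝ≥0∞) = ENNReal.ofReal 2 by simp, ← ENNReal.ofReal_mul (by positivity),
        ← ENNReal.ofReal_inv_of_pos (by norm_num)]
      congr 1
      rw [abs_of_pos (by norm_num)]
      norm_num
    rw [← two_mul, ← mul_assoc, h6, pow_succ']

/-- Running the limiting path from `x` to `y` in time `T` gives a path that respects all
speed-limits. -/
theorem IsRefinement.connectsInTime (h : IsRefinement K α good p q) (hK : 0 ≤ K)
    (hα : 0 ≤ α) (hα' : α ≤ 1 / 4) (hT : 0 < T)
    (hline : ∀ {n x y}, good n x y → ∃ m ∈ L, K * (4 * α) ^ n / T ≤ (m.2 : ℝ) ∧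
      p n x y ∈ m.1.points ∧ q n x y ∈ m.1.points)
    {x y : Euc d} (hxy : good 0 x y) :
    ConnectsInTime L x y T fun t => limitPath p q 0 x y (T⁻¹ * t) := by
  have hlip : LipschitzOnWith ((K * α ^ 0).toNNReal * ‖T⁻¹‖₊)
      (fun t => limitPath p q 0 x y (T⁻¹ * t)) (Icc 0 T) := by
    refine (h.lipschitzOnWith_limitPath hK hα hα' hxy).comp
      ((lipschitzWith_smul T⁻¹).lipschitzOnWith (s := Icc 0 T)) fun t ht => ?_
    refine ⟨mul_nonneg (inv_nonneg.2 hT.le) ht.1, ?_⟩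
    rw [inv_mul_le_one₀ hT]
    exact ht.2
  have hsub : timeInterval (T : EReal) ⊆ Icc 0 T := fun t ht =>
    ⟨ht.1, (EReal.coe_lt_coe_iff.1 ht.2).le⟩
  refine ⟨⟨by exact_mod_cast hT, fun t _ => ⟨_, _, self_mem_nhdsWithin, hlip.mono hsub⟩,
    fun v hv => ?_⟩, hlip.continuousOn, ?_, ?_⟩
  · have hzero : volume (violationTimes L (1 / T) (limitPath p q 0 x y)) = 0 := by
      refine le_antisymm (ge_of_tendsto' (ENNReal.tendsto_pow_atTop_nhds_zero_of_lt_one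
        ENNReal.one_half_lt_one) fun N => ?_) zero_le
      simpa using h.volume_violationTimes_le hK hα hα' hT hline N hxy
    refine measure_mono_null (t := (fun t => T⁻¹ * t) ⁻¹'
      violationTimes L (1 / T) (limitPath p q 0 x y) ∪ {0}) ?_ ?_
    · rintro t ⟨ht, hvt, hsil⟩
      rcases ht.1.eq_or_lt with h0 | h0
      · exact Or.inr h0.symm
      left
      have htT : t < T := EReal.coe_lt_coe_iff.1 ht.2
      refine ⟨⟨mul_pos (inv_pos.2 hT) h0, ?_⟩, v, hv, ?_, hsil⟩
      · rw [inv_mul_lt_one₀ hT]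
        exact htT
      · rw [one_div]
        rwa [deriv_comp_mul_left, norm_smul, norm_inv, Real.norm_of_nonneg hT.le] at hvt
    · rw [measure_union_null_iff, Real.volume_preimage_mul_left (inv_ne_zero hT.ne'), hzero]
      simp
  · simp only [mul_zero]
    exact limitPath_zero_right _ _ _ _ _
  · simp only [inv_mul_cancel₀ hT.ne']
    exact limitPath_one_right _ _ _ _ _

end SpeedLimit

/-! ### Fast lines near all pairs of points -/

theorem exp_neg_le_factorial_div_pow {z : ℝ} (hz : 0 < z) (m : ℕ) :
    Real.exp (-z) ≤ m.factorial / z ^ m := by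
  have hm : (0 : ℝ) < m.factorial := by exact_mod_cast m.factorial_pos
  have h := Real.pow_div_factorial_le_exp z hz.le m
  rw [Real.exp_neg, inv_le_comm₀ (Real.exp_pos z) (by positivity), inv_div]
  exact h

/-- The tail of the speed measure compensates the decay of the line measure: at scale `α ^ n` the
expected number of lines of speed at least `K (4 α) ^ n / T` that serve a given pair of points grows
geometrically in `n`. -/
theorem exists_pos_le_markedLineIntensity (d : ℕ) (hd : 2 ≤ d) {γ α r₀ K : ℝ} (hγ : 1 < γ)
    (hα : 0 < α) (hr₀ : 0 < r₀) (hK : 0 < K) :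
    ∃ c : ℝ, 0 < c ∧ ∀ (T : ℝ) (n : ℕ) (a b : Euc d), 0 < T → ‖b - a‖ ≤ 2 * (r₀ * α ^ n) →
      ENNReal.ofReal (c * T ^ (γ - 1) * ((α ^ (γ - d) * 4 ^ (γ - 1))⁻¹) ^ n) ≤
        markedLineIntensity d γ
          ((linesHitting (Metric.ball a (α / 2 * (r₀ * α ^ n))) ∩
            linesHitting (Metric.ball b (α / 2 * (r₀ * α ^ n)))) ×ˢ
              {w : Ioi (0 : ℝ) | K * (4 * α) ^ n / T ≤ w}) := by
  obtain ⟨c, hc, hline⟩ := exists_pos_le_invariantLineMeasure d hd (δ := α / 2) (by positivity)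
  have hγ' : 0 < γ - 1 := sub_pos.2 hγ
  refine ⟨c * r₀ ^ (d - 1) * ((γ - 1) * 2 ^ (-γ)) * K ^ (1 - γ), by positivity,
    fun T n a b hT hab => ?_⟩
  rw [markedLineIntensity, Measure.prod_prod]
  refine le_trans (le_of_eq ?_) (mul_le_mul' (hline (r₀ * α ^ n) a b (by positivity) hab)
    (le_speedMeasure_setOf_le hγ (v := K * (4 * α) ^ n / T) (by positivity)))
  rw [← ENNReal.ofReal_mul (by positivity)]
  congr 1
  have hT' : T ^ (γ - 1) = (T ^ (1 - γ))⁻¹ := by rw [← Real.rpow_neg hT.le, neg_sub]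
  have hpow : ((4 * α) ^ n) ^ (1 - γ) = ((4 * α) ^ (1 - γ)) ^ n := by
    rw [← Real.rpow_natCast, ← Real.rpow_natCast, ← Real.rpow_mul (by positivity),
      ← Real.rpow_mul (by positivity), mul_comm (n : ℝ)]
  have hq : (α ^ (γ - d) * 4 ^ (γ - 1))⁻¹ = α ^ (d - 1) * (4 * α) ^ (1 - γ) := by
    rw [Real.mul_rpow (by norm_num) hα.le, mul_inv, ← Real.rpow_neg hα.le,
      ← Real.rpow_neg (by norm_num), neg_sub, neg_sub, ← Real.rpow_natCast α (d - 1),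
      Nat.cast_sub (by omega), mul_left_comm, ← Real.rpow_add hα, mul_comm]
    congr 2
    push_cast
    ring
  rw [Real.div_rpow (by positivity) hT.le, Real.mul_rpow hK.le (by positivity), hpow, hq, hT',
    mul_pow, mul_pow, ← pow_mul, ← pow_mul, mul_comm n, div_eq_mul_inv]
  ring

/-- Almost surely all pairs of points at distance at most `r₀ α ^ n` in a ball are joined, up to
errors of order `α ^ (n + 1)`, by a line of speed at least `K (4 α) ^ n / T`, simultaneously for all
`n`. By the union bound over coverings, the failure probability for given `T` is at most the sum over
`n` of `(M ^ 2) ^ (n + 1) * exp (-c T ^ (γ - 1) q ^ (-n))`, which tends to zero as `T → ∞`. -/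
theorem ae_exists_fast_lines (d : ℕ) (hd : 2 ≤ d) {γ α r₀ K : ℝ} (R : ℝ) (hγ : 1 < γ)
    (hα : 0 < α) (hα' : α ≤ 1 / 4) (hq : α ^ (γ - d) * 4 ^ (γ - 1) < 1) (hr₀ : 0 < r₀) (hK : 0 < K)
    {Ω : Type*} [MeasurableSpace Ω] {P : Measure Ω}
    {L : Ω → Set (MarkedLine d)} (hL : IsPoissonProcess P L (markedLineIntensity d γ)) :
    ∀ᵐ ω ∂P, ∃ T : ℝ, 0 < T ∧ ∀ (n : ℕ) (x y : Euc d), ‖x‖ ≤ R → ‖y‖ ≤ R →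
      ‖y - x‖ ≤ r₀ * α ^ n → ∃ m ∈ L ω, K * (4 * α) ^ n / T ≤ (m.2 : ℝ) ∧
        m.1 ∈ linesHitting (Metric.ball x (r₀ * α ^ (n + 1))) ∧
        m.1 ∈ linesHitting (Metric.ball y (r₀ * α ^ (n + 1))) := by
  have hγ' : 0 < γ - 1 := sub_pos.2 hγ
  obtain ⟨c, hc, hint⟩ := exists_pos_le_markedLineIntensity d hd hγ hα hr₀ hK
  obtain ⟨M, hM⟩ := exists_finset_cover (E := Euc d) R (ε := α / 2 * r₀) (α := α) (by positivity) hα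
    (by linarith)
  choose S hS hcov using hM
  set q : ℝ := α ^ (γ - d) * 4 ^ (γ - 1) with hq_def
  have hq0 : 0 < q := by positivity
  obtain ⟨m, hm0, hm⟩ : ∃ m : ℕ, m ≠ 0 ∧ (M : ℝ) ^ 2 * q ^ m ≤ 1 / 2 := by
    have h1 : Tendsto (fun m : ℕ => (M : ℝ) ^ 2 * q ^ m) atTop (𝓝 ((M : ℝ) ^ 2 * 0)) :=
      (tendsto_pow_atTop_nhds_zero_of_lt_one hq0.le hq).const_mul _
    rw [mul_zero] at h1
    obtain ⟨m, h2, h3⟩ := ((h1.eventually_le_const (by norm_num : (0 : ℝ) < 1 / 2)).and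
      (eventually_ne_atTop 0)).exists
    exact ⟨m, h3, h2⟩
  let B : ℝ → ℕ → Euc d × Euc d → Set (MarkedLine d) := fun T n ab =>
    (linesHitting (Metric.ball ab.1 (α / 2 * (r₀ * α ^ n))) ∩
      linesHitting (Metric.ball ab.2 (α / 2 * (r₀ * α ^ n)))) ×ˢ
        {w : Ioi (0 : ℝ) | K * (4 * α) ^ n / T ≤ w}
  have hB : ∀ T n ab, MeasurableSet (B T n ab) := fun T n ab =>
    ((measurableSet_linesHitting Metric.isOpen_ball).inter
      (measurableSet_linesHitting Metric.isOpen_ball)).prod (measurableSet_setOf_le_coe_Ioi _)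
  let fail : ℝ → Set Ω := fun T => ⋃ n, ⋃ ab ∈ S n ×ˢ S n,
    {ω | ‖ab.2 - ab.1‖ ≤ 2 * (r₀ * α ^ n) ∧ L ω ∩ B T n ab = ∅}
  let D : ℝ → ℝ := fun T => (M : ℝ) ^ 2 * m.factorial / c ^ m / (T ^ (γ - 1)) ^ m
  have hfail : ∀ T, 0 < T → P (fail T) ≤ ENNReal.ofReal (D T * 2) := by
    intro T hT
    have hD : 0 ≤ D T := by positivity
    have hterm : ∀ n, P (⋃ ab ∈ S n ×ˢ S n,
        {ω | ‖ab.2 - ab.1‖ ≤ 2 * (r₀ * α ^ n) ∧ L ω ∩ B T n ab = ∅}) ≤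
          ENNReal.ofReal (D T * (1 / 2) ^ n) := by
      intro n
      set z : ℝ := c * T ^ (γ - 1) * (q⁻¹) ^ n with hz_def
      have hz : 0 < z := by positivity
      have hone : ∀ ab ∈ S n ×ˢ S n,
          P {ω | ‖ab.2 - ab.1‖ ≤ 2 * (r₀ * α ^ n) ∧ L ω ∩ B T n ab = ∅} ≤
            ENNReal.ofReal (Real.exp (-z)) := by
        intro ab _
        by_cases hab : ‖ab.2 - ab.1‖ ≤ 2 * (r₀ * α ^ n)
        · exact (measure_mono fun ω hω => hω.2).trans
            (hL.measure_inter_eq_empty_le (hB T n ab) (hint T n ab.1 ab.2 hT hab))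
        · simp [hab]
      refine (measure_biUnion_finset_le _ _).trans ((Finset.sum_le_sum hone).trans ?_)
      rw [Finset.sum_const, nsmul_eq_mul, ← ENNReal.ofReal_natCast,
        ← ENNReal.ofReal_mul (by positivity)]
      refine ENNReal.ofReal_le_ofReal ?_
      have hcard : (((S n ×ˢ S n).card : ℕ) : ℝ) ≤ ((M : ℝ) ^ (n + 1)) ^ 2 := by
        rw [Finset.card_product, sq]
        exact_mod_cast Nat.mul_le_mul (hS n) (hS n)
      calc (((S n ×ˢ S n).card : ℕ) : ℝ) * Real.exp (-z)
          ≤ ((M : ℝ) ^ (n + 1)) ^ 2 * (m.factorial / z ^ m) :=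
            mul_le_mul hcard (exp_neg_le_factorial_div_pow hz m) (Real.exp_pos _).le (by positivity)
        _ = D T * ((M : ℝ) ^ 2 * q ^ m) ^ n := by
            simp only [hz_def, D, mul_pow, inv_pow, ← pow_mul]
            rw [mul_comm n m]
            field_simp
            ring
        _ ≤ D T * (1 / 2) ^ n := by
            gcongr
    calc P (fail T) ≤ ∑' n, ENNReal.ofReal (D T * (1 / 2) ^ n) :=
          (measure_iUnion_le _).trans (ENNReal.tsum_le_tsum hterm)
      _ = ENNReal.ofReal (D T * 2) := by
          rw [← ENNReal.ofReal_tsum_of_nonneg (fun n => by positivity)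
            (summable_geometric_two.mul_left _), tsum_mul_left, tsum_geometric_two]
  have hlim : Tendsto (fun T => ENNReal.ofReal (D T * 2)) atTop (𝓝 0) := by
    have h1 : Tendsto D atTop (𝓝 0) :=
      ((tendsto_pow_atTop hm0).comp (tendsto_rpow_atTop hγ')).const_div_atTop _
    have h2 := ENNReal.tendsto_ofReal (h1.mul_const 2)
    rwa [zero_mul, ENNReal.ofReal_zero] at h2
  rw [ae_iff]
  refine le_antisymm (ge_of_tendsto hlim ?_) zero_le
  filter_upwards [eventually_gt_atTop 0] with T hT
  refine (measure_mono fun ω hω => ?_).trans (hfail T hT)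
  by_contra hnot
  refine hω ⟨T, hT, fun n x y hx hy hxy => ?_⟩
  obtain ⟨a, ha, hxa⟩ := hcov n x hx
  obtain ⟨b, hb, hyb⟩ := hcov n y hy
  have hαn : 0 < r₀ * α ^ n := by positivity
  have hrad : α / 2 * r₀ * α ^ n = α / 2 * (r₀ * α ^ n) := mul_assoc _ _ _
  have hsmall : α / 2 * (r₀ * α ^ n) ≤ 1 / 8 * (r₀ * α ^ n) :=
    mul_le_mul_of_nonneg_right (by linarith) hαn.le
  rw [hrad] at hxa hyb
  have hab : ‖b - a‖ ≤ 2 * (r₀ * α ^ n) := by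
    rw [← dist_eq_norm] at hxy ⊢
    have h1 := dist_triangle4 b y x a
    rw [dist_comm b y] at h1
    linarith
  have hne : (L ω ∩ B T n (a, b)).Nonempty := by
    rw [nonempty_iff_ne_empty]
    intro hempty
    exact hnot (mem_iUnion.2 ⟨n, mem_biUnion (x := (a, b))
      (Finset.mem_coe.2 (Finset.mem_product.2 ⟨ha, hb⟩)) ⟨hab, hempty⟩⟩)
  obtain ⟨l, hlL, ⟨hla, hlb⟩, hspeed⟩ := hne
  have hball : ∀ {u v : Euc d}, dist u v < α / 2 * (r₀ * α ^ n) →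
      Metric.ball v (α / 2 * (r₀ * α ^ n)) ⊆ Metric.ball u (r₀ * α ^ (n + 1)) := by
    intro u v huv
    refine Metric.ball_subset_ball' ?_
    rw [dist_comm, pow_succ]
    linarith
  exact ⟨l, hlL, hspeed, hla.mono (inter_subset_inter_right _ (hball hxa)),
    hlb.mono (inter_subset_inter_right _ (hball hyb))⟩

/-- The condition `γ > d` is what makes the exponent of `α` positive. -/
theorem exists_scale_ratio {d : ℕ} {γ : ℝ} (hγ : (d : ℝ) < γ) :
    ∃ α : ℝ, 0 < α ∧ α ≤ 1 / 4 ∧ α ^ (γ - d) * 4 ^ (γ - 1) < 1 := by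
  have hpos : 0 < γ - d := sub_pos.2 hγ
  have h1 : Tendsto (fun α : ℝ => α ^ (γ - d) * 4 ^ (γ - 1)) (𝓝[>] 0) (𝓝 0) := by
    have h2 := ((Real.continuousAt_rpow_const 0 (γ - d) (Or.inr hpos.le)).tendsto.mono_left
      (nhdsWithin_le_nhds (s := Ioi 0))).mul_const ((4 : ℝ) ^ (γ - 1))
    rwa [Real.zero_rpow hpos.ne', zero_mul] at h2
  have h3 : ∀ᶠ α : ℝ in 𝓝[>] 0, α ≤ 1 / 4 :=
    nhdsWithin_le_nhds (eventually_le_nhds (by norm_num))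
  obtain ⟨α, h4, h5, h6⟩ :=
    ((h1.eventually_lt_const one_pos).and (h3.and self_mem_nhdsWithin)).exists
  exact ⟨α, h6, h5, h4⟩

theorem mainTheorem5 (d : ℕ) (hd : 2 ≤ d) (γ : ℝ) (hγ : (d : ℝ) < γ)
    {Ω : Type*} [MeasurableSpace Ω] (P : Measure Ω) [IsProbabilityMeasure P]
    (L : Ω → Set (MarkedLine d)) (hL : IsPoissonProcess P L (markedLineIntensity d γ))
    (x₁ x₂ : Euc d) :
    ∀ᵐ ω ∂P, ∃ (T : ℝ) (ξ : ℝ → Euc d), ConnectsInTime (L ω) x₁ x₂ T ξ := by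
  obtain ⟨α, hα, hα', hq⟩ := exists_scale_ratio hγ
  have hγ1 : 1 < γ := by
    have : (2 : ℝ) ≤ d := by exact_mod_cast hd
    linarith
  set r₀ : ℝ := ‖x₂ - x₁‖ + 1
  have hr₀ : 0 < r₀ := by positivity
  set R : ℝ := max ‖x₁‖ ‖x₂‖ + 2 * r₀ with hR
  filter_upwards [ae_exists_fast_lines d hd (K := 6 * r₀) R hγ1 hα hα' hq hr₀ (by positivity) hL]
    with ω hω
  obtain ⟨T, hT, hfast⟩ := hω
  -- The bounds on `‖x‖` and `‖y‖` keep all refinements inside the ball of radius `R`.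
  let good : ℕ → Euc d → Euc d → Prop := fun n x y =>
    ‖y - x‖ ≤ r₀ * α ^ n ∧ ‖x‖ ≤ R - 2 * (r₀ * α ^ n) ∧ ‖y‖ ≤ R - 2 * (r₀ * α ^ n)
  have hstep : ∀ n x y, good n x y → ∃ p q, good (n + 1) x p ∧ good (n + 1) q y ∧
      2 * ‖q - p‖ ≤ 6 * r₀ * α ^ n ∧ ∃ m ∈ L ω, 6 * r₀ * (4 * α) ^ n / T ≤ (m.2 : ℝ) ∧
        p ∈ m.1.points ∧ q ∈ m.1.points := by
    rintro n x y ⟨hxy, hx, hy⟩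
    have hn : 0 < r₀ * α ^ n := by positivity
    have hn1 : r₀ * α ^ (n + 1) ≤ 1 / 4 * (r₀ * α ^ n) := by
      have := mul_le_mul_of_nonneg_left hα' hn.le
      rw [pow_succ]
      linarith
    obtain ⟨m, hm, hspeed, ⟨p, hp, hpx⟩, q, hq, hqy⟩ :=
      hfast n x y (by linarith) (by linarith) hxy
    rw [mem_ball_iff_norm] at hpx hqy
    have hpn : ‖p‖ ≤ ‖x‖ + ‖p - x‖ := by simpa using norm_add_le x (p - x)
    have hqn : ‖q‖ ≤ ‖y‖ + ‖q - y‖ := by simpa using norm_add_le y (q - y)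
    have hqp : ‖q - p‖ ≤ ‖q - y‖ + ‖y - x‖ + ‖p - x‖ := by
      rw [← dist_eq_norm, ← dist_eq_norm, ← dist_eq_norm, ← dist_eq_norm, dist_comm p x]
      exact dist_triangle4 q y x p
    refine ⟨p, q, ⟨hpx.le, by linarith, by linarith⟩, ⟨?_, by linarith, by linarith⟩,
      by linarith, m, hm, hspeed, hp, hq⟩
    rw [norm_sub_rev]
    exact hqy.le
  choose! p q hleft hright hmiddle hline using hstep
  have href : IsRefinement (6 * r₀) α good p q := by
    refine ⟨fun {n x y} h => h.1.trans ?_, fun h => hleft _ _ _ h, fun h => hright _ _ _ h,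
      fun h => hmiddle _ _ _ h⟩
    have : 0 < r₀ * α ^ n := by positivity
    linarith
  have hstart : good 0 x₁ x₂ := by
    simp only [good, pow_zero, mul_one, hR, add_sub_cancel_right]
    exact ⟨by simp [r₀], le_max_left _ _, le_max_right _ _⟩
  exact ⟨T, _, href.connectsInTime (by positivity) hα.le hα' hT (fun h => hline _ _ _ h) hstart⟩
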